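/- Let $\ell:[0,+\infty)\to[0,+\infty)$ be a concave function, and let $\mu$ and $\nu$ be two mutually singular Borel probability measures on $\mathbb{R}^n$, with $\mu$ absolutely continuous with respect to the Lebesgue measure. Let $\phi$ be a Kantorovich potential for the transport problem from $\mu$ to $\nu$ with cost $c(x,y)=\ell(|x-y|)$, i.e. there is a function $\psi$ such that $(\phi,\psi)$ maximizes $\int\phi\,d\mu+\int\psi\,d\nu$ among all pairs of continuous functions $\phi\in L^1(\mu)$, $\psi\in L^1(\nu)$ on $\mathbb{R}^n$ with $\phi(x)+\psi(y)\le \ell(|x-y|)$ for all $x,y\in\mathbb{R}^n$. Then $\phi$ is approximately differentiable at $\mu$-a.e. point: for $\mu$-a.e. $x_0\in\mathbb{R}^n$ there exists $v\in\mathbb{R}^n$ (an approximate gradient of $\phi$ at $x_0$) such that for every $\varepsilon>0$ $$\lim_{\delta\to0^+}\frac{\left|\{x\in B(x_0,\delta)\,:\,|\phi(x)-\phi(x_0)-v\cdot(x-x_0)|>\varepsilon|x-x_0|\}\right|}{|B(x_0,\delta)|}=0,$$ where $|\cdot|$ of a set denotes its Lebesgue measure. -/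

import Mathlib

open MeasureTheory Filter Topology

/-- `(φ, ψ)` is admissible in the dual Kantorovich problem with cost `c` and marginals `μ`, `ν`:
`φ`, `ψ` are continuous, the integrals `∫ φ dμ` and `∫ ψ dν` make sense,
and `φ x + ψ y ≤ c x y` for all `x`, `y`. -/
structure IsDualAdmissible {X Y : Type*} [TopologicalSpace X] [MeasurableSpace X]
    [TopologicalSpace Y] [MeasurableSpace Y] (c : X → Y → ℝ) (μ : Measure X) (ν : Measure Y)
    (φ : X → ℝ) (ψ : Y → ℝ) : Prop where
  continuous_fst : Continuous φ
  continuous_snd : Continuous ψ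
  integrable_fst : Integrable φ μ
  integrable_snd : Integrable ψ ν
  le_cost : ∀ x y, φ x + ψ y ≤ c x y

/-- `(φ, ψ)` solves the dual Kantorovich problem: it maximizes `∫ φ dμ + ∫ ψ dν` among all
admissible pairs. -/
def IsDualOptimal {X Y : Type*} [TopologicalSpace X] [MeasurableSpace X]
    [TopologicalSpace Y] [MeasurableSpace Y] (c : X → Y → ℝ) (μ : Measure X) (ν : Measure Y)
    (φ : X → ℝ) (ψ : Y → ℝ) : Prop :=
  IsDualAdmissible c μ ν φ ψ ∧
    ∀ (φ' : X → ℝ) (ψ' : Y → ℝ), IsDualAdmissible c μ ν φ' ψ' →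
      ∫ x, φ' x ∂μ + ∫ y, ψ' y ∂ν ≤ ∫ x, φ x ∂μ + ∫ y, ψ y ∂ν

/-- `φ` is a Kantorovich potential for the transport of `μ` to `ν` with cost `c`: it is the first
component of a solution of the dual problem. (No conjugacy is asked for; the solutions
`(φ, φᶜ)` with `φᶜ` the `c`-transform of `φ` are included.) -/
def IsKantorovichPotential {X Y : Type*} [TopologicalSpace X] [MeasurableSpace X]
    [TopologicalSpace Y] [MeasurableSpace Y] (c : X → Y → ℝ) (μ : Measure X) (ν : Measure Y)
    (φ : X → ℝ) : Prop :=
  ∃ ψ : Y → ℝ, IsDualOptimal c μ ν φ ψ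

/-- `v` is an approximate gradient of `f` at `x₀`: for every `ε > 0` the set where
`|f x - f x₀ - ⟪v, x - x₀⟫| > ε |x - x₀|` has Lebesgue density zero at `x₀`. -/
def HasApproxGradientAt {n : ℕ} (f : EuclideanSpace ℝ (Fin n) → ℝ)
    (v x₀ : EuclideanSpace ℝ (Fin n)) : Prop :=
  ∀ ε : ℝ, 0 < ε →
    Tendsto
      (fun δ : ℝ =>
        volume ({x | ε * ‖x - x₀‖ < |f x - f x₀ - inner ℝ v (x - x₀)|} ∩ Metric.ball x₀ δ) /
          volume (Metric.ball x₀ δ))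
      (𝓝[>] 0) (𝓝 0)

/-- `f` is approximately differentiable at `x₀`. -/
def ApproxDifferentiableAt {n : ℕ} (f : EuclideanSpace ℝ (Fin n) → ℝ)
    (x₀ : EuclideanSpace ℝ (Fin n)) : Prop :=
  ∃ v, HasApproxGradientAt f v x₀

/-! By mutual singularity and optimality, `μ`-a.e. `x` has a partner `y ≠ x` with `φ x + ψ y = c x
y`: otherwise a compact, `ν`-null set of unsaturated points would allow an improved dual pair. When
`|x - y| ≥ r > 0`, `ℓ` is Lipschitz near `|x - y|`, and comparing `φ x' ≤ c x' y - ψ y` with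
equality at `x` bounds `φ x' - φ x`. So countably many compact sets, on each of which `φ` is
Lipschitz, cover `μ`-almost everything. Rademacher's theorem and Lebesgue density finish, since `μ ≪
volume`. -/

open Set Metric in
/-- If `φ x + ψ y < c x y` on a product `K ×ˢ C` of compact sets and `μ K > ν Cᶜ`, then `(φ, ψ)` can
be improved by raising `φ` near `K` and lowering `ψ` off `C`. -/
theorem IsDualOptimal.measure_le_of_forall_lt {X : Type*} [MetricSpace X] [MeasurableSpace X]
    [BorelSpace X] {c : X → X → ℝ}
    (hc : ContinuousOn (fun p : X × X => c p.1 p.2) {p | p.1 ≠ p.2})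
    {μ ν : Measure X} [IsFiniteMeasure μ] [IsFiniteMeasure ν] {φ ψ : X → ℝ}
    (h : IsDualOptimal c μ ν φ ψ) {K C : Set X} (hK : IsCompact K) (hC : IsCompact C)
    (hKC : Disjoint K C) (hlt : ∀ x ∈ K, ∀ y ∈ C, φ x + ψ y < c x y) :
    μ.real K ≤ ν.real Cᶜ := by
  obtain ⟨⟨hφ, hψ, hφi, hψi, hle⟩, hopt⟩ := h
  have hoff : IsOpen {p : X × X | p.1 ≠ p.2} := isOpen_ne_fun continuous_fst continuous_snd
  have hslack : ContinuousOn (fun p : X × X => c p.1 p.2 - (φ p.1 + ψ p.2)) {p | p.1 ≠ p.2} :=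
    hc.sub (by fun_prop)
  have hsub : K ×ˢ C ⊆ {p : X × X | p.1 ≠ p.2} := fun p hp => hKC.ne_of_mem hp.1 hp.2
  obtain ⟨η, hη, hgap⟩ : ∃ η : ℝ, 0 < η ∧
      ∀ p ∈ K ×ˢ C, η < c p.1 p.2 - (φ p.1 + ψ p.2) := by
    rcases (K ×ˢ C).eq_empty_or_nonempty with he | hne
    · exact ⟨1, one_pos, by simp [he]⟩
    · obtain ⟨q, hq, hmin⟩ := (hK.prod hC).exists_isMinOn hne (hslack.mono hsub)
      have hpos := sub_pos.2 (hlt q.1 hq.1 q.2 hq.2)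
      exact ⟨_, half_pos hpos, fun p hp => (half_lt_self hpos).trans_le (hmin hp)⟩
  -- The gap `η` persists on `u ×ˢ v`, where it absorbs the raise `η * f`. Outside `u` nothing is
  -- raised; outside `v` the full drop `η` compensates.
  obtain ⟨u, v, hu, hv, hKu, hCv, huv⟩ := generalized_tube_lemma hK hC
    (hslack.isOpen_inter_preimage hoff (isOpen_Ioi (a := η)))
    (fun p hp => ⟨hsub hp, hgap p hp⟩)
  obtain ⟨f, hf0, hf1, hf⟩ := exists_continuous_zero_one_of_isClosed hu.isClosed_compl
    hK.isClosed (disjoint_compl_left.mono_right hKu)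
  obtain ⟨g, hg0, hg1, hg⟩ := exists_continuous_zero_one_of_isClosed hC.isClosed
    hv.isClosed_compl (disjoint_compl_right.mono_left hCv)
  have hfi : Integrable f μ := Integrable.of_bound f.continuous.aestronglyMeasurable 1
    (.of_forall fun x => by rw [Real.norm_of_nonneg (hf x).1]; exact (hf x).2)
  have hgi : Integrable g ν := Integrable.of_bound g.continuous.aestronglyMeasurable 1
    (.of_forall fun x => by rw [Real.norm_of_nonneg (hg x).1]; exact (hg x).2)
  have hadm : IsDualAdmissible c μ ν (fun x => φ x + η * f x) (fun y => ψ y - η * g y) := by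
    refine ⟨by fun_prop, by fun_prop, hφi.add (hfi.const_mul η), hψi.sub (hgi.const_mul η), ?_⟩
    intro x y
    have hxy := hle x y
    have hfη : η * f x ≤ η := mul_le_of_le_one_right hη.le (hf x).2
    have hgη : 0 ≤ η * g y := mul_nonneg hη.le (hg y).1
    by_cases hx : x ∈ u
    · by_cases hy : y ∈ v
      · have : η < c x y - (φ x + ψ y) := (huv (mk_mem_prod hx hy)).2
        linarith
      · have : g y = 1 := hg1 hy
        rw [this, mul_one]
        linarith
    · have : f x = 0 := hf0 hx
      rw [this, mul_zero]
      linarith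
  have hint := hopt _ _ hadm
  rw [integral_add hφi (hfi.const_mul η), integral_sub hψi (hgi.const_mul η),
    integral_const_mul, integral_const_mul] at hint
  have hfg : ∫ x, f x ∂μ ≤ ∫ y, g y ∂ν := by
    refine le_of_mul_le_mul_left ?_ hη
    linarith
  have hKf : μ.real K ≤ ∫ x, f x ∂μ := by
    rw [← integral_indicator_one hK.measurableSet]
    refine integral_mono ((integrable_const 1).indicator hK.measurableSet) hfi fun x => ?_
    by_cases hx : x ∈ K
    · simpa [hx] using (hf1 hx).ge
    · simpa [hx] using (hf x).1
  have hgC : ∫ y, g y ∂ν ≤ ν.real Cᶜ := by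
    rw [← integral_indicator_one hC.measurableSet.compl]
    refine integral_mono hgi ((integrable_const 1).indicator hC.measurableSet.compl) fun x => ?_
    by_cases hx : x ∈ C
    · simpa [hx] using (hg0 hx).le
    · simpa [hx] using (hg x).2
  linarith

/-- The pairs `(x, y)` at distance at least `r` from each other, in the closed ball of radius `R`
about `o`, at which the dual constraint is saturated. -/
def saturatedPairs {X : Type*} [PseudoMetricSpace X] (c : X → X → ℝ) (φ ψ : X → ℝ) (o : X)
    (r R : ℝ) : Set (X × X) :=
  {p | r ≤ dist p.1 p.2} ∩ Metric.closedBall o R ×ˢ Metric.closedBall o R ∩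
    {p | c p.1 p.2 ≤ φ p.1 + ψ p.2}

/-- The cost may jump on the diagonal, so `0 < r` is what makes saturation a closed condition. -/
theorem isCompact_saturatedPairs {X : Type*} [MetricSpace X] [ProperSpace X] {c : X → X → ℝ}
    (hc : ContinuousOn (fun p : X × X => c p.1 p.2) {p | p.1 ≠ p.2}) {φ ψ : X → ℝ}
    (hφ : Continuous φ) (hψ : Continuous ψ) (o : X) {r : ℝ} (hr : 0 < r) (R : ℝ) :
    IsCompact (saturatedPairs c φ ψ o r R) := by
  have hfar : IsClosed {p : X × X | r ≤ dist p.1 p.2} := isClosed_le (by fun_prop) (by fun_prop)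
  have hbox : IsCompact (Metric.closedBall o R ×ˢ Metric.closedBall o R) :=
    (isCompact_closedBall o R).prod (isCompact_closedBall o R)
  refine (hbox.inter_left hfar).of_isClosed_subset ?_ Set.inter_subset_left
  have hslack : ContinuousOn (fun p : X × X => c p.1 p.2 - (φ p.1 + ψ p.2))
      ({p | r ≤ dist p.1 p.2} ∩ Metric.closedBall o R ×ˢ Metric.closedBall o R) :=
    (hc.mono fun p hp => dist_pos.1 (hr.trans_le hp.1)).sub (by fun_prop)
  have := hslack.preimage_isClosed_of_isClosed (hfar.inter hbox.isClosed) (isClosed_Iic (a := 0))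
  convert this using 1
  ext p
  simp [saturatedPairs]

/-- If the marginals are mutually singular, then `μ`-almost every point is the first component of a
saturated pair off the diagonal. -/
theorem IsDualOptimal.ae_exists_mem_saturatedPairs {X : Type*} [MetricSpace X] [ProperSpace X]
    [MeasurableSpace X] [BorelSpace X] {c : X → X → ℝ}
    (hc : ContinuousOn (fun p : X × X => c p.1 p.2) {p | p.1 ≠ p.2})
    {μ ν : Measure X} [IsFiniteMeasure μ] [IsFiniteMeasure ν] (hμν : μ.MutuallySingular ν)
    {φ ψ : X → ℝ} (h : IsDualOptimal c μ ν φ ψ) (o : X) :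
    ∀ᵐ x ∂μ, ∃ k : ℕ, x ∈ Prod.fst '' saturatedPairs c φ ψ o (1 / (k + 1)) k := by
  have hcomp (k : ℕ) : IsCompact (Prod.fst '' saturatedPairs c φ ψ o (1 / (k + 1)) k) :=
    (isCompact_saturatedPairs hc h.1.continuous_fst h.1.continuous_snd o (by positivity) k).image
      continuous_fst
  obtain ⟨S, hS, hμS, hνS⟩ := hμν
  set F : Set X := ⋃ k : ℕ, Prod.fst '' saturatedPairs c φ ψ o (1 / (k + 1)) k with hF
  have hFm : MeasurableSet F := .iUnion fun k => (hcomp k).measurableSet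
  suffices hzero : μ (Fᶜ ∩ Sᶜ) = 0 by
    have : μ Fᶜ = 0 := by
      refine measure_mono_null (fun x hx => ?_) (measure_union_null hzero hμS)
      by_cases hxS : x ∈ S
      · exact Or.inr hxS
      · exact Or.inl ⟨hx, hxS⟩
    filter_upwards [mem_ae_iff.2 (by rwa [compl_compl] : μ (Fᶜ)ᶜᶜ = 0)] with x hx
    simpa [hF] using hx
  by_contra hne
  obtain ⟨K, hKsub, hK, hKpos⟩ := (hFm.compl.inter hS.compl).exists_lt_isCompact_of_ne_top
    (measure_ne_top μ _) (pos_iff_ne_zero.2 hne)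
  have hνK : ν K = 0 := measure_mono_null (fun x hx => (hKsub hx).2) hνS
  -- Since `ν K = 0`, a compact `C` disjoint from `K` can carry all but less than `μ K` of the mass
  -- of `ν`.
  obtain ⟨C, hCsub, hC, hCν⟩ := hK.measurableSet.compl.exists_isCompact_lt_add
    (measure_ne_top ν _) hKpos.ne'
  have hlt : ∀ x ∈ K, ∀ y ∈ C, φ x + ψ y < c x y := by
    intro x hx y hy
    by_contra! hle
    have hxy : 0 < dist x y := dist_pos.2 fun e => hCsub hy (e ▸ hx)
    obtain ⟨k₁, hk₁⟩ := exists_nat_one_div_lt hxy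
    obtain ⟨k₂, hk₂⟩ := exists_nat_ge (max (dist x o) (dist y o))
    refine (hKsub hx).1 (Set.mem_iUnion.2 ⟨max k₁ k₂, (x, y), ⟨⟨?_, ?_, ?_⟩, hle⟩, rfl⟩)
    · refine le_trans ?_ hk₁.le
      exact one_div_le_one_div_of_le (by positivity) (by push_cast; gcongr; exact le_max_left _ _)
    · exact (le_max_left _ _).trans (hk₂.trans (by push_cast; exact le_max_right _ _))
    · exact (le_max_right _ _).trans (hk₂.trans (by push_cast; exact le_max_right _ _))
  have hmeas := h.measure_le_of_forall_lt hc hK hC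
    (Set.disjoint_left.2 fun x hx hxC => hCsub hxC hx) hlt
  have hcompl : ν Cᶜ < μ K := by
    rw [measure_compl hC.measurableSet (measure_ne_top ν _)]
    refine ENNReal.sub_lt_of_lt_add (measure_mono (Set.subset_univ _)) ?_
    rwa [← measure_add_measure_compl hK.measurableSet, hνK, zero_add, add_comm]
  exact hmeas.not_gt ((ENNReal.toReal_lt_toReal (measure_ne_top ν _) (measure_ne_top μ _)).2 hcompl)

/-- If `x' ↦ c x' y` is Lipschitz on the ball of radius `ρ` about `x`, uniformly in the saturated
pairs `(x, y)`, then `φ` is Lipschitz on the set of first components of these pairs. -/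
theorem exists_lipschitzOnWith_of_forall_saturated {X Y : Type*} [PseudoMetricSpace X]
    {c : X → Y → ℝ} {φ : X → ℝ} {ψ : Y → ℝ} (hle : ∀ x y, φ x + ψ y ≤ c x y)
    {D : Set X} (hD : IsCompact D) {ρ : ℝ} (hρ : 0 < ρ) {L : ℝ} (hL : 0 ≤ L)
    (h : ∀ x ∈ D, ∃ y, c x y ≤ φ x + ψ y ∧ ∀ x', dist x' x < ρ → c x' y ≤ c x y + L * dist x' x) :
    ∃ M, LipschitzOnWith M φ D := by
  refine LocallyLipschitzOn.exists_lipschitzOnWith_of_compact hD fun x₀ _ => ?_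
  refine ⟨⟨L, hL⟩, D ∩ Metric.ball x₀ (ρ / 2),
    inter_mem_nhdsWithin D (Metric.ball_mem_nhds x₀ (by positivity)),
    LipschitzOnWith.of_le_add_mul _ fun x hx x' hx' => ?_⟩
  -- The partner of `x'` bounds `φ x` from above; exchanging the roles of the points gives the other
  -- bound.
  obtain ⟨y, hy, hc⟩ := h x' hx'.1
  have hd : dist x x' < ρ := by
    have h₁ := Metric.mem_ball.1 hx.2
    have h₂ := Metric.mem_ball.1 hx'.2
    linarith [dist_triangle_right x x' x₀]
  have := hc x hd
  have := hle x y
  change φ x ≤ φ x' + L * dist x x'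
  linarith

/-- A function that is Lipschitz on a measurable set is approximately differentiable at almost every
point of it. -/
theorem LipschitzOnWith.ae_approxDifferentiableAt {n : ℕ} {f : EuclideanSpace ℝ (Fin n) → ℝ}
    {M : NNReal} {D : Set (EuclideanSpace ℝ (Fin n))} (hf : LipschitzOnWith M f D)
    (hD : MeasurableSet D) : ∀ᵐ x, x ∈ D → ApproxDifferentiableAt f x := by
  -- At a density point of `D`, the derivative within `D` is an approximate one: close to `x`, bad
  -- points lie in `Dᶜ`.
  filter_upwards [hf.ae_differentiableWithinAt_of_mem (μ := volume),
    Besicovitch.ae_tendsto_measure_inter_div_of_measurableSet volume hD.compl] with x hx hdens hxD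
  rw [Set.indicator_of_notMem (by simpa using hxD)] at hdens
  refine ⟨(InnerProductSpace.toDual ℝ _).symm (fderivWithin ℝ f D x), fun ε hε => ?_⟩
  have hbound := (hx hxD).hasFDerivWithinAt.isLittleO.bound hε
  obtain ⟨δ₀, hδ₀, hball⟩ := Metric.mem_nhdsWithin_iff.1 hbound
  refine tendsto_of_tendsto_of_tendsto_of_le_of_le' tendsto_const_nhds hdens
    (.of_forall fun _ => zero_le) ?_
  filter_upwards [Ioo_mem_nhdsGT hδ₀] with δ hδ
  have hvol : volume (Metric.closedBall x δ) = volume (Metric.ball x δ) := by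
    rw [Measure.addHaar_closedBall volume x hδ.1.le, Measure.addHaar_ball_of_pos volume x hδ.1]
  rw [hvol]
  refine ENNReal.div_le_div_right (measure_mono fun z hz =>
    Set.mem_inter (fun hzD => ?_) (Metric.ball_subset_closedBall hz.2)) _
  have hz' := hball ⟨Metric.ball_subset_ball hδ.2.le hz.2, hzD⟩
  have hz₁ := hz.1
  simp only [Set.mem_ofPred_eq, InnerProductSpace.toDual_symm_apply, Real.norm_eq_abs] at hz' hz₁
  exact hz₁.not_ge hz'

theorem ConcaveOn.continuousOn_comp_norm_sub {E : Type*} [NormedAddCommGroup E] {ℓ : ℝ → ℝ}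
    (hℓ : ConcaveOn ℝ (Set.Ici 0) ℓ) :
    ContinuousOn (fun p : E × E => ℓ ‖p.1 - p.2‖) {p | p.1 ≠ p.2} := by
  have hcont := hℓ.continuousOn_interior
  rw [interior_Ici] at hcont
  exact hcont.comp (by fun_prop) fun p hp => norm_pos_iff.2 (sub_ne_zero.2 hp)

theorem ConcaveOn.exists_lipschitzOnWith_Icc {ℓ : ℝ → ℝ} (hℓ : ConcaveOn ℝ (Set.Ici 0) ℓ) {a : ℝ}
    (ha : 0 < a) (b : ℝ) : ∃ L, LipschitzOnWith L ℓ (Set.Icc a b) := by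
  have hloc := hℓ.locallyLipschitzOn_interior
  rw [interior_Ici] at hloc
  exact (hloc.mono fun t ht => ha.trans_le ht.1).exists_lipschitzOnWith_of_compact isCompact_Icc

/-- A dual solution `φ` for a cost `ℓ ‖x - y‖` with `ℓ` concave is Lipschitz on the set of first
components of the saturated pairs that are bounded and bounded away from the diagonal. -/
theorem exists_lipschitzOnWith_fst_image_saturatedPairs {E : Type*} [NormedAddCommGroup E]
    [ProperSpace E] {ℓ : ℝ → ℝ} (hℓ : ConcaveOn ℝ (Set.Ici 0) ℓ) {φ ψ : E → ℝ}
    (hφ : Continuous φ) (hψ : Continuous ψ) (hle : ∀ x y, φ x + ψ y ≤ ℓ ‖x - y‖) {r : ℝ}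
    (hr : 0 < r) (R : ℝ) :
    ∃ M, LipschitzOnWith M φ
      (Prod.fst '' saturatedPairs (fun x y => ℓ ‖x - y‖) φ ψ 0 r R) := by
  -- Moving `x` by less than `r / 2` keeps its distance to `y` in this interval.
  obtain ⟨L, hL⟩ := hℓ.exists_lipschitzOnWith_Icc (half_pos hr) (2 * R + r)
  refine exists_lipschitzOnWith_of_forall_saturated hle
    ((isCompact_saturatedPairs hℓ.continuousOn_comp_norm_sub hφ hψ 0 hr R).image continuous_fst)
    (half_pos hr) L.coe_nonneg ?_
  rintro _ ⟨⟨x, y⟩, ⟨⟨hfar, hxR, hyR⟩, hsat⟩, rfl⟩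
  refine ⟨y, hsat, fun x' hx' => ?_⟩
  simp only [Set.mem_ofPred_eq, mem_closedBall_zero_iff, dist_eq_norm] at hfar hxR hyR hx' ⊢
  have hdiff : |‖x' - y‖ - ‖x - y‖| ≤ ‖x' - x‖ := by
    simpa using abs_norm_sub_norm_le (x' - y) (x - y)
  have hupper : ‖x - y‖ ≤ 2 * R := by linarith [norm_sub_le x y]
  obtain ⟨h₁, h₂⟩ := abs_le.1 hdiff
  have hℓ' := hL.le_add_mul (x := ‖x' - y‖) ⟨by linarith, by linarith⟩
    (y := ‖x - y‖) ⟨by linarith, by linarith⟩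
  rw [Real.dist_eq] at hℓ'
  linarith [mul_le_mul_of_nonneg_left hdiff L.coe_nonneg]

theorem mainTheorem6 {n : ℕ} (ℓ : ℝ → ℝ) (hℓ : ConcaveOn ℝ (Set.Ici 0) ℓ)
    (hℓ_nonneg : ∀ t : ℝ, 0 ≤ t → 0 ≤ ℓ t)
    (μ ν : Measure (EuclideanSpace ℝ (Fin n))) [IsProbabilityMeasure μ] [IsProbabilityMeasure ν]
    (hμν : μ.MutuallySingular ν) (hμ : μ.AbsolutelyContinuous volume)
    (φ : EuclideanSpace ℝ (Fin n) → ℝ)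
    (hφ : IsKantorovichPotential (fun x y => ℓ ‖x - y‖) μ ν φ) :
    ∀ᵐ x ∂μ, ApproxDifferentiableAt φ x := by
  obtain ⟨ψ, hopt⟩ := hφ
  obtain ⟨hφc, hψc, -, -, hle⟩ := hopt.1
  have hdiff : ∀ᵐ x ∂μ, ∀ k : ℕ,
      x ∈ Prod.fst '' saturatedPairs (fun x y => ℓ ‖x - y‖) φ ψ 0 (1 / (k + 1)) k →
        ApproxDifferentiableAt φ x := by
    refine hμ.ae_le (ae_all_iff.2 fun k => ?_)
    have hk : (0 : ℝ) < 1 / (k + 1) := by positivity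
    obtain ⟨M, hM⟩ := exists_lipschitzOnWith_fst_image_saturatedPairs hℓ hφc hψc hle hk k
    exact hM.ae_approxDifferentiableAt
      ((isCompact_saturatedPairs hℓ.continuousOn_comp_norm_sub hφc hψc 0 hk k).image
        continuous_fst).measurableSet
  filter_upwards [hdiff,
    hopt.ae_exists_mem_saturatedPairs hℓ.continuousOn_comp_norm_sub hμν 0] with x hx ⟨k, hk⟩
  exact hx k hk
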